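/- Let $d$ be a non-zero integer that is not divisible by the fourth power of any prime, and let $E^d/\mathbb{Q}$ be the elliptic curve $y^2 = x^3 + dx$. Let $\mathbb{Q}(E^d[8])$ be its $8$-division field, i.e. the subfield of $\overline{\mathbb{Q}}$ generated over $\mathbb{Q}$ by the coordinates of all affine points $P \in E^d(\overline{\mathbb{Q}})$ with $8P = O$. Then: (1) $[\mathbb{Q}(E^d[8]):\mathbb{Q}] = 16$ if and only if $d \in \{\pm 1, \pm 2, \pm 4, \pm 8\}$. (2) $[\mathbb{Q}(E^d[8]):\mathbb{Q}] = 32$ if and only if $d = \pm t^2$ or $d = \pm 2t^2$ for some square-free integer $t \notin \{\pm 1, \pm 2\}$. (3) $[\mathbb{Q}(E^d[8]):\mathbb{Q}] = 64$ in all remaining cases, i.e. if $d \notin \{\pm 1, \pm 2, \pm 4, \pm 8\}$ and $d$ is not of the form $\pm t^2$ or $\pm 2t^2$ with $t$ a square-free integer, $t \notin \{\pm 1, \pm 2\}$. -/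

import Mathlib

/-- The Weierstrass curve `E^d : y ^ 2 = x ^ 3 + d * x` over `ℚ`. -/
def curveE (d : ℤ) : WeierstrassCurve ℚ where
  a₁ := 0
  a₂ := 0
  a₃ := 0
  a₄ := d
  a₆ := 0

open scoped Classical in
/-- The `n`-division field `K(W[n])` of a Weierstrass curve `W` over a field `K`: the subfield of an
algebraic closure of `K` generated over `K` by the coordinates of all affine points `P` of `W` over
the algebraic closure with `n • P = 0`. -/
noncomputable def divisionField {K : Type*} [Field K] (W : WeierstrassCurve K) (n : ℕ) :
    IntermediateField K (AlgebraicClosure K) :=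
  IntermediateField.adjoin K
    {z : AlgebraicClosure K |
      ∃ (x y : AlgebraicClosure K) (h : (W.baseChange (AlgebraicClosure K)).toAffine.Nonsingular x y),
        n • WeierstrassCurve.Affine.Point.some x y h = 0 ∧ (z = x ∨ z = y)}

/-- An integer is fourth-power-free if no fourth power of a prime number divides it. -/
def FourthPowerFree (d : ℤ) : Prop :=
  ∀ p : ℕ, p.Prime → ¬ ((p : ℤ) ^ 4 ∣ d)

/-!
Over a field containing a square root `s` of `-a` the curve is `y ^ 2 = x * (x - s) * (x + s)`, and
a point is twice a rational point exactly when its `x`, `x - s` and `x + s` are squares. Up to sign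
the `x`-coordinates of the `4`-torsion are `s * ξ` with `ξ = 0, 1, i, 1 + √2, 1 - √2`, so the
`8`-torsion is rational over a field exactly when the field contains `√s` and the square roots of
all `ξ`, `ξ - 1` and `ξ + 1`; these are generated by `i`, `⁴√2` and `√(1 + i)`. As `-1` is the
fourth power of an eighth root of unity, `√s` may be replaced by a fourth root `δ` of `a`.

The field `T = k(i, ⁴√2, √(1 + i))` has degree `16`, and since `√-1 ∈ T` the extension `T(δ) / T`
has degree `1`, `2` or `4` according to whether `δ`, `δ ^ 2` or only `δ ^ 4` lies in `T`. By Kummer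
theory for quadratic extensions the elements of `k` that become squares in `T` are `± r ^ 2` and
`± 2 * r ^ 2`; applying this twice gives the fourth powers.
-/

open IntermediateField

section HasSqrtIn

variable {Ω S : Type*} [Field Ω] [SetLike S Ω] {F : S} {x y : Ω}

/-- `x` has a square root belonging to `F`. For a subfield `F` this says that `x` is a square of
`F`, without having to regard `x` as an element of the type `F`. -/
def HasSqrtIn (F : S) (x : Ω) : Prop :=
  ∃ r ∈ F, r ^ 2 = x

theorem HasSqrtIn.sq (hx : x ∈ F) : HasSqrtIn F (x ^ 2) :=
  ⟨x, hx, rfl⟩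

variable [SubfieldClass S Ω]

theorem hasSqrtIn_zero : HasSqrtIn F (0 : Ω) :=
  ⟨0, zero_mem F, by simp⟩

theorem hasSqrtIn_one : HasSqrtIn F (1 : Ω) :=
  ⟨1, one_mem F, one_pow 2⟩

theorem HasSqrtIn.mul (hx : HasSqrtIn F x) (hy : HasSqrtIn F y) : HasSqrtIn F (x * y) := by
  obtain ⟨r, hr, rfl⟩ := hx
  obtain ⟨t, ht, rfl⟩ := hy
  exact ⟨r * t, mul_mem hr ht, mul_pow r t 2⟩

theorem HasSqrtIn.div (hx : HasSqrtIn F x) (hy : HasSqrtIn F y) : HasSqrtIn F (x / y) := by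
  obtain ⟨r, hr, rfl⟩ := hx
  obtain ⟨t, ht, rfl⟩ := hy
  exact ⟨r / t, div_mem hr ht, div_pow r t 2⟩

theorem hasSqrtIn_sq_iff : HasSqrtIn F (x ^ 2) ↔ x ∈ F := by
  refine ⟨fun ⟨r, hr, h⟩ => ?_, HasSqrtIn.sq⟩
  rcases sq_eq_sq_iff_eq_or_eq_neg.1 h with rfl | rfl
  exacts [hr, neg_mem_iff.1 hr]

end HasSqrtIn

section QuadraticExtension

variable {k Ω : Type*} [Field k] [Field Ω] [Algebra k Ω] {F : IntermediateField k Ω} {α c : Ω}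

theorem mem_sup_adjoin_simple_self (F : IntermediateField k Ω) (α : Ω) : α ∈ F ⊔ k⟮α⟯ :=
  (le_sup_right : k⟮α⟯ ≤ F ⊔ k⟮α⟯) (mem_adjoin_simple_self k α)

theorem isIntegral_of_sq_mem (hα : α ^ 2 ∈ F) : IsIntegral F α :=
  IsIntegral.of_pow two_pos (isIntegral_algebraMap (R := F) (x := ⟨α ^ 2, hα⟩))

theorem exists_eq_add_mul_of_mem_sup_adjoin_simple (hα : α ^ 2 ∈ F) {x : Ω}
    (hx : x ∈ F ⊔ k⟮α⟯) : ∃ a ∈ F, ∃ b ∈ F, x = a + b * α := by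
  rw [← restrictScalars_adjoin_eq_sup, mem_restrictScalars, ← mem_toSubalgebra,
    adjoin_simple_toSubalgebra_of_isAlgebraic (isIntegral_of_sq_mem hα).isAlgebraic] at hx
  induction hx using Algebra.adjoin_induction with
  | mem y hy =>
    obtain rfl := Set.mem_singleton_iff.1 hy
    exact ⟨0, F.zero_mem, 1, F.one_mem, by simp⟩
  | algebraMap r => exact ⟨r, r.2, 0, F.zero_mem, by simp⟩
  | add y z _ _ ihy ihz =>
    obtain ⟨a, ha, b, hb, rfl⟩ := ihy
    obtain ⟨c, hc, e, he, rfl⟩ := ihz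
    exact ⟨a + c, F.add_mem ha hc, b + e, F.add_mem hb he, by ring⟩
  | mul y z _ _ ihy ihz =>
    obtain ⟨a, ha, b, hb, rfl⟩ := ihy
    obtain ⟨c, hc, e, he, rfl⟩ := ihz
    exact ⟨a * c + b * e * α ^ 2, F.add_mem (F.mul_mem ha hc) (F.mul_mem (F.mul_mem hb he) hα),
      a * e + b * c, F.add_mem (F.mul_mem ha he) (F.mul_mem hb hc), by ring⟩

theorem eq_and_eq_of_add_mul_eq_add_mul (hαF : α ∉ F) {a b a' b' : Ω} (ha : a ∈ F) (hb : b ∈ F)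
    (ha' : a' ∈ F) (hb' : b' ∈ F) (h : a + b * α = a' + b' * α) : a = a' ∧ b = b' := by
  have hbb' : b = b' := by
    by_contra hne
    have hα : α = (a' - a) / (b - b') := by
      rw [eq_div_iff (sub_ne_zero.2 hne)]
      linear_combination h
    exact hαF (hα ▸ F.div_mem (F.sub_mem ha' ha) (F.sub_mem hb hb'))
  exact ⟨by linear_combination h - α * hbb', hbb'⟩

theorem exists_sq_add_sq_mul_eq_and_two_mul_eq (hα : α ^ 2 ∈ F) (hαF : α ∉ F) {c e : Ω}
    (hc : c ∈ F) (he : e ∈ F) (h : HasSqrtIn (F ⊔ k⟮α⟯) (c + e * α)) :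
    ∃ a ∈ F, ∃ b ∈ F, a ^ 2 + b ^ 2 * α ^ 2 = c ∧ 2 * a * b = e := by
  obtain ⟨β, hβ, hβc⟩ := h
  obtain ⟨a, ha, b, hb, rfl⟩ := exists_eq_add_mul_of_mem_sup_adjoin_simple hα hβ
  refine ⟨a, ha, b, hb, eq_and_eq_of_add_mul_eq_add_mul hαF ?_ ?_ hc he ?_⟩
  · exact F.add_mem (pow_mem ha 2) (F.mul_mem (pow_mem hb 2) hα)
  · exact F.mul_mem (F.mul_mem (ofNat_mem F 2) ha) hb
  · linear_combination hβc

theorem HasSqrtIn.of_sup_adjoin_simple [NeZero (2 : Ω)] (hα : α ^ 2 ∈ F) (hc : c ∈ F)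
    (h : HasSqrtIn (F ⊔ k⟮α⟯) c) : HasSqrtIn F c ∨ HasSqrtIn F (c * α ^ 2) := by
  by_cases hαF : α ∈ F
  · rw [sup_eq_left.2 (adjoin_simple_le_iff.2 hαF)] at h
    exact Or.inl h
  obtain ⟨a, ha, b, hb, rfl, hab⟩ :=
    exists_sq_add_sq_mul_eq_and_two_mul_eq hα hαF hc F.zero_mem (by simpa using h)
  rcases mul_eq_zero.1 hab with h2a | rfl
  · obtain rfl : a = 0 := (mul_eq_zero.1 h2a).resolve_left (NeZero.ne 2)
    exact Or.inr ⟨b * α ^ 2, F.mul_mem hb hα, by ring⟩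
  · exact Or.inl ⟨a, ha, by ring⟩

/- If `c * α = (a + b * α) ^ 2` then `a ^ 2 = -b ^ 2 * α ^ 2`, and `-1` being a square of `F`
would put `α` into `F`. -/
theorem not_hasSqrtIn_sup_adjoin_simple_mul (hi : HasSqrtIn F (-1 : Ω)) (hα : α ^ 2 ∈ F)
    (hαF : α ∉ F) (hc : c ∈ F) (hc0 : c ≠ 0) : ¬ HasSqrtIn (F ⊔ k⟮α⟯) (c * α) := by
  intro h
  obtain ⟨a, ha, b, hb, hsum, rfl⟩ :=
    exists_sq_add_sq_mul_eq_and_two_mul_eq hα hαF F.zero_mem hc (by simpa using h)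
  have hb0 : b ≠ 0 := right_ne_zero_of_mul hc0
  have hα_eq : α ^ 2 = -1 * (a / b) ^ 2 := by
    field_simp
    linear_combination hsum
  exact hαF (hasSqrtIn_sq_iff.1 (hα_eq ▸ hi.mul (.sq (F.div_mem ha hb))))

theorem natDegree_minpoly_eq_two_of_sq_mem (hα : α ^ 2 ∈ F) (hαF : α ∉ F) :
    (minpoly F α).natDegree = 2 := by
  apply le_antisymm
  · have hmonic := Polynomial.monic_X_pow_sub_C (⟨α ^ 2, hα⟩ : F) two_ne_zero
    have hdvd := minpoly.dvd F α (p := .X ^ 2 - .C ⟨α ^ 2, hα⟩) (by simp)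
    rw [← Polynomial.natDegree_X_pow_sub_C (n := 2) (r := (⟨α ^ 2, hα⟩ : F))]
    exact Polynomial.natDegree_le_of_dvd hdvd hmonic.ne_zero
  · rw [minpoly.two_le_natDegree_iff (isIntegral_of_sq_mem hα)]
    rintro ⟨y, rfl⟩
    exact hαF y.2

theorem finrank_sup_adjoin_simple_of_sq_mem (hα : α ^ 2 ∈ F) (hαF : α ∉ F) :
    Module.finrank k ↥(F ⊔ k⟮α⟯) = Module.finrank k F * 2 := by
  rw [← restrictScalars_adjoin_eq_sup, ← natDegree_minpoly_eq_two_of_sq_mem hα hαF,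
    ← adjoin.finrank (isIntegral_of_sq_mem hα)]
  exact (Module.finrank_mul_finrank k F F⟮α⟯).symm

end QuadraticExtension

section FourthRoot

variable {k Ω : Type*} [Field k] [Field Ω] [Algebra k Ω] {F : IntermediateField k Ω} {δ c : Ω}

theorem sup_adjoin_simple_eq_sup_sq_sup (F : IntermediateField k Ω) (δ : Ω) :
    F ⊔ k⟮δ⟯ = F ⊔ k⟮δ ^ 2⟯ ⊔ k⟮δ⟯ := by
  rw [sup_assoc, sup_eq_right.2 (adjoin_simple_le_iff.2 (pow_mem (mem_adjoin_simple_self k δ) 2))]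

theorem HasSqrtIn.of_sup_adjoin_fourth_root [NeZero (2 : Ω)] (hi : HasSqrtIn F (-1 : Ω))
    (hδ : δ ^ 4 ∈ F) (hδF : δ ^ 2 ∉ F) (hc : c ∈ F) (hc0 : c ≠ 0)
    (h : HasSqrtIn (F ⊔ k⟮δ⟯) c) : HasSqrtIn F c ∨ HasSqrtIn F (c * δ ^ 4) := by
  have hδ' : (δ ^ 2) ^ 2 ∈ F := by rwa [← pow_mul]
  rw [sup_adjoin_simple_eq_sup_sq_sup] at h
  rcases h.of_sup_adjoin_simple (mem_sup_adjoin_simple_self F _) (le_sup_left (a := F) hc)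
    with h | h
  · simpa only [← pow_mul] using h.of_sup_adjoin_simple hδ' hc
  · exact absurd h (not_hasSqrtIn_sup_adjoin_simple_mul hi hδ' hδF hc hc0)

theorem finrank_sup_adjoin_fourth_root (hi : HasSqrtIn F (-1 : Ω)) (hδ : δ ^ 4 ∈ F)
    (hδF : δ ^ 2 ∉ F) : Module.finrank k ↥(F ⊔ k⟮δ⟯) = Module.finrank k F * 4 := by
  have hδ' : (δ ^ 2) ^ 2 ∈ F := by rwa [← pow_mul]
  have hδ_notMem : δ ∉ F ⊔ k⟮δ ^ 2⟯ := by
    have h := not_hasSqrtIn_sup_adjoin_simple_mul hi hδ' hδF F.one_mem one_ne_zero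
    rwa [one_mul, hasSqrtIn_sq_iff] at h
  rw [sup_adjoin_simple_eq_sup_sq_sup,
    finrank_sup_adjoin_simple_of_sq_mem (mem_sup_adjoin_simple_self F _) hδ_notMem,
    finrank_sup_adjoin_simple_of_sq_mem hδ' hδF, Nat.mul_assoc]

end FourthRoot

section AdjoinSqrtNegOne

variable {k Ω : Type*} [Field k] [Field Ω] [Algebra k Ω] {i : Ω} {c : k}

theorem hasSqrtIn_bot_iff :
    HasSqrtIn (⊥ : IntermediateField k Ω) (algebraMap k Ω c) ↔ IsSquare c := by
  constructor
  · rintro ⟨_, hr, h⟩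
    obtain ⟨r, rfl⟩ := mem_bot.1 hr
    rw [← map_pow] at h
    exact (isSquare_iff_exists_sq _).2 ⟨r, ((algebraMap k Ω).injective h).symm⟩
  · rintro ⟨r, rfl⟩
    exact ⟨algebraMap k Ω r, IntermediateField.algebraMap_mem _ r, by rw [map_mul, sq]⟩

theorem notMem_bot_of_sq_eq_neg_one (hk : ¬ IsSquare (-1 : k)) (hi : i ^ 2 = -1) :
    i ∉ (⊥ : IntermediateField k Ω) := by
  rwa [← hasSqrtIn_sq_iff, hi, ← map_one (algebraMap k Ω), ← map_neg, hasSqrtIn_bot_iff]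

theorem isSquare_or_isSquare_neg_of_hasSqrtIn_adjoin [NeZero (2 : Ω)] (hi : i ^ 2 = -1)
    (h : HasSqrtIn k⟮i⟯ (algebraMap k Ω c)) : IsSquare c ∨ IsSquare (-c) := by
  rw [← bot_sup_eq k⟮i⟯] at h
  have hi_mem : i ^ 2 ∈ (⊥ : IntermediateField k Ω) := hi ▸ neg_mem (one_mem _)
  rcases h.of_sup_adjoin_simple hi_mem (IntermediateField.algebraMap_mem _ c) with h | h
  · exact .inl (hasSqrtIn_bot_iff.1 h)
  · right
    rwa [hi, mul_neg_one, ← map_neg, hasSqrtIn_bot_iff] at h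

/- If `c * (1 + i) = (a + b * i) ^ 2` then `a ^ 2 - b ^ 2 = c = 2 * a * b`, so taking norms
`(a ^ 2 + b ^ 2) ^ 2 = 2 * c ^ 2`. -/
theorem not_hasSqrtIn_adjoin_mul_one_add (h1 : ¬ IsSquare (-1 : k)) (h2 : ¬ IsSquare (2 : k))
    (hi : i ^ 2 = -1) (hc : c ≠ 0) :
    ¬ HasSqrtIn k⟮i⟯ (algebraMap k Ω c * (1 + i)) := by
  intro h
  rw [← bot_sup_eq k⟮i⟯, mul_one_add] at h
  have hcF : algebraMap k Ω c ∈ (⊥ : IntermediateField k Ω) := IntermediateField.algebraMap_mem _ c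
  obtain ⟨_, ha, _, hb, hsub, hmul⟩ :=
    exists_sq_add_sq_mul_eq_and_two_mul_eq (hi ▸ neg_mem (one_mem _))
      (notMem_bot_of_sq_eq_neg_one h1 hi) hcF hcF h
  obtain ⟨a, rfl⟩ := mem_bot.1 ha
  obtain ⟨b, rfl⟩ := mem_bot.1 hb
  have hnorm : 2 = ((a ^ 2 + b ^ 2) / c) ^ 2 := by
    rw [div_pow, eq_div_iff (pow_ne_zero 2 hc)]
    apply (algebraMap k Ω).injective
    simp only [map_mul, map_add, map_pow, map_ofNat]
    linear_combination -(algebraMap k Ω a ^ 2 - algebraMap k Ω b ^ 2 + algebraMap k Ω c) * hsub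
      - (2 * algebraMap k Ω a * algebraMap k Ω b + algebraMap k Ω c) * hmul
      + algebraMap k Ω b ^ 2 * (algebraMap k Ω a ^ 2 - algebraMap k Ω b ^ 2 + algebraMap k Ω c) * hi
  exact h2 ((isSquare_iff_exists_sq _).2 ⟨_, hnorm⟩)

theorem sq_notMem_adjoin_of_pow_four_eq_two {w : Ω} [NeZero (2 : Ω)] (h2 : ¬ IsSquare (2 : k))
    (hneg2 : ¬ IsSquare (-2 : k)) (hi : i ^ 2 = -1) (hw : w ^ 4 = 2) : w ^ 2 ∉ k⟮i⟯ := by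
  rw [← hasSqrtIn_sq_iff, ← pow_mul, hw, ← map_ofNat (algebraMap k Ω)]
  exact fun h => (isSquare_or_isSquare_neg_of_hasSqrtIn_adjoin hi h).elim h2 hneg2

end AdjoinSqrtNegOne

/-- A choice of radicals `i = √-1`, `w = ⁴√2`, `u = √(1 + i)`. They generate the `8`-division field
of `y ^ 2 = x ^ 3 - x`. -/
structure Radicals (Ω : Type*) [Field Ω] where
  i : Ω
  w : Ω
  u : Ω
  i_sq : i ^ 2 = -1
  w_pow_four : w ^ 4 = 2
  u_sq : u ^ 2 = 1 + i

/-- None of `-1`, `2`, `-2` is a square in `k`: equivalently, the eighth roots of unity generate an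
extension of degree `4` of `k`. -/
structure IndependentNegOneTwo (k : Type*) [Field k] : Prop where
  not_isSquare_neg_one : ¬ IsSquare (-1 : k)
  not_isSquare_two : ¬ IsSquare (2 : k)
  not_isSquare_neg_two : ¬ IsSquare (-2 : k)

theorem IndependentNegOneTwo.neZero_two {k : Type*} [Field k] (hk : IndependentNegOneTwo k)
    (Ω : Type*) [Field Ω] [Algebra k Ω] : NeZero (2 : Ω) := by
  refine ⟨fun h => hk.not_isSquare_two ?_⟩
  rw [← map_ofNat (algebraMap k Ω), map_eq_zero] at h
  exact h ▸ IsSquare.zero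

namespace Radicals

theorem nonempty_of_isAlgClosed (Ω : Type*) [Field Ω] [IsAlgClosed Ω] : Nonempty (Radicals Ω) := by
  obtain ⟨i, hi⟩ := IsAlgClosed.exists_pow_nat_eq (-1 : Ω) two_pos
  obtain ⟨w, hw⟩ := IsAlgClosed.exists_pow_nat_eq (2 : Ω) four_pos
  obtain ⟨u, hu⟩ := IsAlgClosed.exists_pow_nat_eq (1 + i) two_pos
  exact ⟨⟨i, w, u, hi, hw, hu⟩⟩

section Zeta

variable {Ω S : Type*} [Field Ω] (ρ : Radicals Ω) [SetLike S Ω] {F : S}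

/-- The primitive eighth root of unity `(1 + i) / √2`. -/
def zeta : Ω := (1 + ρ.i) / ρ.w ^ 2

theorem hasSqrtIn_neg_one (hi : ρ.i ∈ F) : HasSqrtIn F (-1 : Ω) :=
  ρ.i_sq ▸ .sq hi

variable [SubfieldClass S Ω]

theorem zeta_mem (hi : ρ.i ∈ F) (hw : ρ.w ∈ F) : ρ.zeta ∈ F :=
  div_mem (add_mem (one_mem F) hi) (pow_mem hw 2)

variable [NeZero (2 : Ω)]

theorem one_add_i_ne_zero : 1 + ρ.i ≠ 0 := by
  intro h
  refine two_ne_zero (α := Ω) ?_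
  linear_combination ρ.i_sq + (1 - ρ.i) * h

theorem w_ne_zero : ρ.w ≠ 0 := by
  have h := ρ.w_pow_four
  intro h0
  exact two_ne_zero (by simpa [h0] using h.symm : (2 : Ω) = 0)

theorem zeta_sq : ρ.zeta ^ 2 = ρ.i := by
  have hw := ρ.w_ne_zero
  rw [zeta, div_pow, div_eq_iff (by positivity)]
  linear_combination ρ.i_sq - ρ.i * ρ.w_pow_four

theorem zeta_pow_four : ρ.zeta ^ 4 = -1 := by
  linear_combination (ρ.zeta ^ 2 + ρ.i) * ρ.zeta_sq + ρ.i_sq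

/- With `t = w ^ 2 = √2` and `ζ = (1 + i) / t` one has `(1 + ζ) ^ 2 = (1 + i) * (1 + t)`. -/
theorem hasSqrtIn_one_add_w_sq (hi : ρ.i ∈ F) (hw : ρ.w ∈ F) (hu : ρ.u ∈ F) :
    HasSqrtIn F (1 + ρ.w ^ 2) := by
  refine ⟨(1 + ρ.zeta) / ρ.u, div_mem (add_mem (one_mem F) (ρ.zeta_mem hi hw)) hu, ?_⟩
  have hζ : ρ.zeta * ρ.w ^ 2 = 1 + ρ.i := div_mul_cancel₀ _ (pow_ne_zero 2 ρ.w_ne_zero)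
  rw [div_pow, ρ.u_sq, div_eq_iff ρ.one_add_i_ne_zero]
  linear_combination ρ.zeta_sq - ρ.zeta * ρ.w_pow_four + ρ.w ^ 2 * hζ

theorem hasSqrtIn_one_sub_w_sq (hi : ρ.i ∈ F) (hw : ρ.w ∈ F) (hu : ρ.u ∈ F) :
    HasSqrtIn F (1 - ρ.w ^ 2) := by
  have h0 : 1 + ρ.w ^ 2 ≠ 0 := by
    intro h
    refine one_ne_zero (α := Ω) ?_
    linear_combination (ρ.w ^ 2 - 1) * h - ρ.w_pow_four
  have h_eq : 1 - ρ.w ^ 2 = -1 / (1 + ρ.w ^ 2) := by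
    rw [eq_div_iff h0]
    linear_combination -ρ.w_pow_four
  exact h_eq ▸ (ρ.hasSqrtIn_neg_one hi).div (ρ.hasSqrtIn_one_add_w_sq hi hw hu)

theorem hasSqrtIn_one_sub_i (hw : ρ.w ∈ F) (hu : ρ.u ∈ F) : HasSqrtIn F (1 - ρ.i) := by
  refine ⟨ρ.w ^ 2 / ρ.u, div_mem (pow_mem hw 2) hu, ?_⟩
  rw [div_pow, ρ.u_sq, div_eq_iff ρ.one_add_i_ne_zero]
  linear_combination ρ.w_pow_four + ρ.i_sq

end Zeta

variable {k Ω : Type*} [Field k] [Field Ω] [Algebra k Ω] (ρ : Radicals Ω) {a : k} {δ : Ω}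

variable (k) in
/-- The field `k(i, ⁴√2, √(1 + i))`. -/
def field : IntermediateField k Ω := k⟮ρ.i⟯ ⊔ k⟮ρ.w⟯ ⊔ k⟮ρ.u⟯

theorem field_le_iff {F : IntermediateField k Ω} :
    ρ.field k ≤ F ↔ ρ.i ∈ F ∧ ρ.w ∈ F ∧ ρ.u ∈ F := by
  simp only [field, sup_le_iff, adjoin_simple_le_iff, and_assoc]

theorem i_mem_field : ρ.i ∈ ρ.field k := (ρ.field_le_iff.1 le_rfl).1

theorem w_mem_field : ρ.w ∈ ρ.field k := (ρ.field_le_iff.1 le_rfl).2.1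

theorem u_sq_mem : ρ.u ^ 2 ∈ k⟮ρ.i⟯ ⊔ k⟮ρ.w⟯ :=
  ρ.u_sq ▸ add_mem (one_mem _) (le_sup_left (a := k⟮ρ.i⟯) (mem_adjoin_simple_self k _))

section Tower

variable (hk : IndependentNegOneTwo k)
include hk

theorem w_sq_notMem_adjoin_i : ρ.w ^ 2 ∉ k⟮ρ.i⟯ :=
  have := hk.neZero_two Ω
  sq_notMem_adjoin_of_pow_four_eq_two hk.not_isSquare_two hk.not_isSquare_neg_two ρ.i_sq
    ρ.w_pow_four

theorem hasSqrtIn_adjoin_i_of_sup_adjoin_w {c : Ω} (hc : c ∈ k⟮ρ.i⟯) (hc0 : c ≠ 0)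
    (h : HasSqrtIn (k⟮ρ.i⟯ ⊔ k⟮ρ.w⟯) c) : HasSqrtIn k⟮ρ.i⟯ c ∨ HasSqrtIn k⟮ρ.i⟯ (2 * c) := by
  have := hk.neZero_two Ω
  rw [← ρ.w_pow_four, mul_comm]
  exact HasSqrtIn.of_sup_adjoin_fourth_root (ρ.hasSqrtIn_neg_one (mem_adjoin_simple_self k _))
    (ρ.w_pow_four ▸ ofNat_mem _ 2) (ρ.w_sq_notMem_adjoin_i hk) hc hc0 h

theorem not_hasSqrtIn_sup_adjoin_w_mul_one_add_i (ha : a ≠ 0) :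
    ¬ HasSqrtIn (k⟮ρ.i⟯ ⊔ k⟮ρ.w⟯) (algebraMap k Ω a * (1 + ρ.i)) := by
  have := hk.neZero_two k
  have := hk.neZero_two Ω
  have not_hasSqrtIn {c : k} (hc : c ≠ 0) : ¬ HasSqrtIn k⟮ρ.i⟯ (algebraMap k Ω c * (1 + ρ.i)) :=
    not_hasSqrtIn_adjoin_mul_one_add hk.not_isSquare_neg_one hk.not_isSquare_two ρ.i_sq hc
  have hi : ρ.i ∈ k⟮ρ.i⟯ := mem_adjoin_simple_self k ρ.i
  intro h
  have hmem : algebraMap k Ω a * (1 + ρ.i) ∈ k⟮ρ.i⟯ :=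
    mul_mem (IntermediateField.algebraMap_mem _ a) (add_mem (one_mem _) hi)
  rcases ρ.hasSqrtIn_adjoin_i_of_sup_adjoin_w hk hmem (by simp [ha, ρ.one_add_i_ne_zero]) h
    with h | h
  · exact not_hasSqrtIn ha h
  · refine not_hasSqrtIn (mul_ne_zero two_ne_zero ha) ?_
    rwa [map_mul, map_ofNat, mul_assoc]

theorem u_notMem : ρ.u ∉ k⟮ρ.i⟯ ⊔ k⟮ρ.w⟯ := by
  have h := ρ.not_hasSqrtIn_sup_adjoin_w_mul_one_add_i hk (one_ne_zero (α := k))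
  rwa [map_one, one_mul, ← ρ.u_sq, hasSqrtIn_sq_iff] at h

theorem finrank_field : Module.finrank k (ρ.field k) = 16 := by
  have hi : Module.finrank k k⟮ρ.i⟯ = 2 := by
    rw [← bot_sup_eq k⟮ρ.i⟯, finrank_sup_adjoin_simple_of_sq_mem (ρ.i_sq ▸ neg_mem (one_mem _))
      (notMem_bot_of_sq_eq_neg_one hk.not_isSquare_neg_one ρ.i_sq), IntermediateField.finrank_bot]
  rw [field, finrank_sup_adjoin_simple_of_sq_mem ρ.u_sq_mem (ρ.u_notMem hk),
    finrank_sup_adjoin_fourth_root (ρ.hasSqrtIn_neg_one (mem_adjoin_simple_self k _))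
      (ρ.w_pow_four ▸ ofNat_mem _ 2) (ρ.w_sq_notMem_adjoin_i hk), hi]

theorem exists_eq_mul_sq_of_hasSqrtIn_field (h : HasSqrtIn (ρ.field k) (algebraMap k Ω a)) :
    ∃ e ∈ ({1, -1, 2, -2} : Set k), ∃ r, a = e * r ^ 2 := by
  rcases eq_or_ne a 0 with rfl | ha
  · exact ⟨1, by simp, 0, by simp⟩
  have := hk.neZero_two k
  have := hk.neZero_two Ω
  have haF {F : IntermediateField k Ω} : algebraMap k Ω a ∈ F := F.algebraMap_mem a
  have h_iw : HasSqrtIn (k⟮ρ.i⟯ ⊔ k⟮ρ.w⟯) (algebraMap k Ω a) := by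
    refine (h.of_sup_adjoin_simple ρ.u_sq_mem haF).resolve_right ?_
    exact ρ.u_sq ▸ ρ.not_hasSqrtIn_sup_adjoin_w_mul_one_add_i hk ha
  rcases ρ.hasSqrtIn_adjoin_i_of_sup_adjoin_w hk haF (by simpa) h_iw with h_i | h_i
  · rcases isSquare_or_isSquare_neg_of_hasSqrtIn_adjoin ρ.i_sq h_i with ⟨r, hr⟩ | ⟨r, hr⟩
    · exact ⟨1, by simp, r, by linear_combination hr⟩
    · exact ⟨-1, by simp, r, by linear_combination -hr⟩
  · rw [← map_ofNat (algebraMap k Ω), ← map_mul] at h_i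
    rcases isSquare_or_isSquare_neg_of_hasSqrtIn_adjoin ρ.i_sq h_i with ⟨r, hr⟩ | ⟨r, hr⟩
    · refine ⟨2, by simp, r / 2, ?_⟩
      field_simp
      linear_combination hr
    · refine ⟨-2, by simp, r / 2, ?_⟩
      field_simp
      linear_combination -hr

end Tower

section FourthRoots

theorem exists_mem_field_pow_four_eq [NeZero (2 : Ω)] {c : k}
    (hc : c ∈ ({1, -1, 2, -2, 4, -4, 8, -8} : Set k)) :
    ∃ η ∈ ρ.field k, η ^ 4 = algebraMap k Ω c := by
  suffices ∃ m n : ℕ, (-1) ^ m * 2 ^ n = c by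
    obtain ⟨m, n, rfl⟩ := this
    have hζ : ρ.zeta ∈ ρ.field k := ρ.zeta_mem ρ.i_mem_field ρ.w_mem_field
    refine ⟨_, mul_mem (pow_mem hζ m) (pow_mem ρ.w_mem_field n), ?_⟩
    rw [mul_pow, pow_right_comm, pow_right_comm ρ.w, ρ.zeta_pow_four, ρ.w_pow_four]
    simp only [map_mul, map_pow, map_neg, map_one, map_ofNat]
  rcases hc with rfl | rfl | rfl | rfl | rfl | rfl | rfl | rfl
  exacts [⟨0, 0, by norm_num⟩, ⟨1, 0, by norm_num⟩, ⟨0, 1, by norm_num⟩, ⟨1, 1, by norm_num⟩,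
    ⟨0, 2, by norm_num⟩, ⟨1, 2, by norm_num⟩, ⟨0, 3, by norm_num⟩, ⟨1, 3, by norm_num⟩]

theorem mem_field_of_pow_four_eq {η : Ω} (hη : η ∈ ρ.field k) (h : δ ^ 4 = η ^ 4) :
    δ ∈ ρ.field k := by
  have hsq : (δ ^ 2) ^ 2 = (η ^ 2) ^ 2 := by rw [← pow_mul, ← pow_mul, h]
  refine hasSqrtIn_sq_iff.1 ?_
  rcases sq_eq_sq_iff_eq_or_eq_neg.1 hsq with h | h
  · exact h ▸ .sq hη
  · rw [h, neg_eq_neg_one_mul]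
    exact (ρ.hasSqrtIn_neg_one ρ.i_mem_field).mul (.sq hη)

variable (hk : IndependentNegOneTwo k)
include hk

theorem hasSqrtIn_field_iff : HasSqrtIn (ρ.field k) (algebraMap k Ω a) ↔
    ∃ e ∈ ({1, -1, 2, -2} : Set k), ∃ r, a = e * r ^ 2 := by
  refine ⟨ρ.exists_eq_mul_sq_of_hasSqrtIn_field hk, ?_⟩
  rintro ⟨e, he, r, rfl⟩
  have := hk.neZero_two Ω
  obtain ⟨η, hη, hηe⟩ := ρ.exists_mem_field_pow_four_eq (k := k) (c := e) (by grind)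
  exact ⟨η ^ 2 * algebraMap k Ω r, mul_mem (pow_mem hη 2) (IntermediateField.algebraMap_mem _ r), by
    rw [mul_pow, ← pow_mul, hηe, map_mul, map_pow]⟩

/- Write `δ ^ 4 = e * r ^ 2` with `e = η ^ 4`, `η` in the field. Then `(δ / η) ^ 2 = ± r`, so that
`r` is again a square in the field. -/
theorem exists_eq_mul_pow_four_of_mem_field (hδ : δ ^ 4 = algebraMap k Ω a)
    (hmem : δ ∈ ρ.field k) :
    ∃ c ∈ ({1, -1, 2, -2, 4, -4, 8, -8} : Set k), ∃ r, a = c * r ^ 4 := by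
  have := hk.neZero_two Ω
  obtain ⟨e, he, r, rfl⟩ := ρ.exists_eq_mul_sq_of_hasSqrtIn_field hk
    ⟨δ ^ 2, pow_mem hmem 2, by rw [← pow_mul, hδ]⟩
  obtain ⟨η, hη, hηe⟩ := ρ.exists_mem_field_pow_four_eq (k := k) (c := e) (by grind)
  have he0 : e ≠ 0 := by
    have := hk.neZero_two k
    rcases he with rfl | rfl | rfl | rfl <;> simp [NeZero.ne (2 : k)]
  have hη0 : η ≠ 0 := by
    rintro rfl
    exact he0 (by simpa using hηe.symm)
  have hquot : ((δ / η) ^ 2) ^ 2 = algebraMap k Ω r ^ 2 := by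
    rw [← pow_mul, div_pow, hδ, map_mul, map_pow, ← hηe, mul_div_cancel_left₀ _ (by simpa)]
  have hquot_mem : HasSqrtIn (ρ.field k) ((δ / η) ^ 2) := .sq (div_mem hmem hη)
  have hr : HasSqrtIn (ρ.field k) (algebraMap k Ω r) := by
    rcases sq_eq_sq_iff_eq_or_eq_neg.1 hquot with h | h
    · exact h ▸ hquot_mem
    · simpa [h] using (ρ.hasSqrtIn_neg_one ρ.i_mem_field).mul hquot_mem
  obtain ⟨e', he', q, rfl⟩ := ρ.exists_eq_mul_sq_of_hasSqrtIn_field hk hr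
  refine ⟨e * e' ^ 2, ?_, q, by ring⟩
  rcases he with rfl | rfl | rfl | rfl <;> rcases he' with rfl | rfl | rfl | rfl <;> norm_num

theorem mem_field_iff_of_pow_four_eq (hδ : δ ^ 4 = algebraMap k Ω a) : δ ∈ ρ.field k ↔
    ∃ c ∈ ({1, -1, 2, -2, 4, -4, 8, -8} : Set k), ∃ r, a = c * r ^ 4 := by
  refine ⟨ρ.exists_eq_mul_pow_four_of_mem_field hk hδ, ?_⟩
  rintro ⟨c, hc, r, rfl⟩
  have := hk.neZero_two Ω
  obtain ⟨η, hη, hηc⟩ := ρ.exists_mem_field_pow_four_eq hc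
  refine ρ.mem_field_of_pow_four_eq (mul_mem hη (IntermediateField.algebraMap_mem _ r)) ?_
  rw [hδ, mul_pow, hηc, map_mul, map_pow]

theorem finrank_field_sup_adjoin_of_sq_mem (hδ : δ ^ 2 ∈ ρ.field k) (hδF : δ ∉ ρ.field k) :
    Module.finrank k ↥(ρ.field k ⊔ k⟮δ⟯) = 32 := by
  rw [finrank_sup_adjoin_simple_of_sq_mem hδ hδF, ρ.finrank_field hk]

theorem finrank_field_sup_adjoin_of_pow_four_mem (hδ : δ ^ 4 ∈ ρ.field k)
    (hδF : δ ^ 2 ∉ ρ.field k) : Module.finrank k ↥(ρ.field k ⊔ k⟮δ⟯) = 64 := by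
  rw [finrank_sup_adjoin_fourth_root (ρ.hasSqrtIn_neg_one ρ.i_mem_field) hδ hδF, ρ.finrank_field hk]

end FourthRoots

end Radicals

section Halving

variable {R F : Type*} [CommRing R] [Field F]

/-- The curve `y ^ 2 = x ^ 3 + a * x`, a quartic twist of `y ^ 2 = x ^ 3 - x`. Over a field
containing a square root `s` of `-a` it is `y ^ 2 = x * (x - s) * (x + s)`. -/
def quarticTwist (a : R) : WeierstrassCurve R := ⟨0, 0, 0, a, 0⟩

namespace quarticTwist

open WeierstrassCurve.Affine WeierstrassCurve.Affine.Point

theorem baseChange_eq {A : Type*} [CommRing A] [Algebra R A] (a : R) :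
    (quarticTwist a).baseChange A = quarticTwist (algebraMap R A a) := by
  ext <;> simp [quarticTwist, WeierstrassCurve.baseChange]

theorem negY_eq (a x y : R) : (quarticTwist a).toAffine.negY x y = -y := by
  simp [WeierstrassCurve.Affine.negY, quarticTwist]

variable {α s a b c x y : F}

/- If the three factors of the cubic at `a ^ 2` are `a ^ 2`, `b ^ 2` and `c ^ 2`, then a half of the
point `(a ^ 2, a * b * c)` is `((a + b) * (a + c), (a + b) * (a + c) * (b + c))`. -/
theorem half_sub (hb : b ^ 2 = a ^ 2 - s) : (a + b) * (a + c) - s = (a + b) * (b + c) := by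
  linear_combination -hb

theorem half_add (hc : c ^ 2 = a ^ 2 + s) : (a + b) * (a + c) + s = (a + c) * (b + c) := by
  linear_combination -hc

variable [NeZero (2 : F)]

theorem nonsingular_iff (hα : α ≠ 0) :
    (quarticTwist α).toAffine.Nonsingular x y ↔ y ^ 2 = x ^ 3 + α * x := by
  have hΔ : (quarticTwist α).Δ = -2 ^ 6 * α ^ 3 := by
    simp only [quarticTwist, WeierstrassCurve.Δ, WeierstrassCurve.b₂, WeierstrassCurve.b₄,
      WeierstrassCurve.b₆, WeierstrassCurve.b₈]
    ring
  have hΔ0 : (quarticTwist α).Δ ≠ 0 := by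
    rw [hΔ]
    exact mul_ne_zero (neg_ne_zero.2 (pow_ne_zero 6 two_ne_zero)) (pow_ne_zero 3 hα)
  rw [← equation_iff_nonsingular_of_Δ_ne_zero hΔ0, equation_iff]
  simp [quarticTwist]

theorem ne_negY (hy : y ≠ 0) : y ≠ (quarticTwist α).toAffine.negY x y := by
  rw [negY_eq]
  intro h
  exact hy (by simpa [two_ne_zero] using (by linear_combination h : 2 * y = 0))

theorem two_nsmul_eq_zero_iff [DecidableEq F] (h : (quarticTwist α).toAffine.Nonsingular x y) :
    2 • some x y h = 0 ↔ y = 0 := by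
  rw [two_nsmul]
  refine ⟨fun h2 => ?_, fun hy => add_self_of_Y_eq (by rw [negY_eq, hy, _root_.neg_zero])⟩
  by_contra hy
  rw [add_self_of_Y_ne (ne_negY hy)] at h2
  exact some_ne_zero _ h2

theorem nonsingular_neg_sq_iff (hs : s ≠ 0) :
    (quarticTwist (-s ^ 2)).toAffine.Nonsingular x y ↔ y ^ 2 = x * (x - s) * (x + s) := by
  rw [nonsingular_iff (neg_ne_zero.2 (pow_ne_zero 2 hs))]
  ring_nf

theorem half_y_ne_zero (hs : s ≠ 0) (hb : b ^ 2 = a ^ 2 - s) (hc : c ^ 2 = a ^ 2 + s) :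
    (a + b) * (a + c) * (b + c) ≠ 0 := by
  refine mul_ne_zero (mul_ne_zero ?_ ?_) ?_ <;> intro h
  · exact hs (by linear_combination (a - b) * h + hb)
  · exact hs (by linear_combination (c - a) * h - hc)
  · have h2s : 2 * s = 0 := by linear_combination (c - b) * h - hc + hb
    exact hs (by simpa [two_ne_zero] using h2s)

theorem nonsingular_half (hs : s ≠ 0) (hb : b ^ 2 = a ^ 2 - s) (hc : c ^ 2 = a ^ 2 + s) :
    (quarticTwist (-s ^ 2)).toAffine.Nonsingular ((a + b) * (a + c))
      ((a + b) * (a + c) * (b + c)) := by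
  rw [nonsingular_neg_sq_iff hs, half_sub hb, half_add hc]
  ring

theorem nonsingular_double (hs : s ≠ 0) (hb : b ^ 2 = a ^ 2 - s) (hc : c ^ 2 = a ^ 2 + s) :
    (quarticTwist (-s ^ 2)).toAffine.Nonsingular (a ^ 2) (a * b * c) := by
  rw [nonsingular_neg_sq_iff hs, ← hb, ← hc]
  ring

theorem slope_half [DecidableEq F] (hs : s ≠ 0) (hb : b ^ 2 = a ^ 2 - s) (hc : c ^ 2 = a ^ 2 + s) :
    (quarticTwist (-s ^ 2)).toAffine.slope ((a + b) * (a + c)) ((a + b) * (a + c))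
      ((a + b) * (a + c) * (b + c)) ((a + b) * (a + c) * (b + c)) = a + b + c := by
  have hy := half_y_ne_zero hs hb hc
  rw [slope_of_Y_ne rfl (ne_negY hy), negY_eq, sub_neg_eq_add, ← two_mul,
    div_eq_iff (mul_ne_zero two_ne_zero hy)]
  simp only [quarticTwist]
  linear_combination (2 * ((a + b) * (a + c)) + s) * half_sub (c := c) hb +
    (a + b) * (a + b + 2 * c) * half_add (b := b) hc

theorem two_nsmul_half [DecidableEq F] (hs : s ≠ 0) (hb : b ^ 2 = a ^ 2 - s)
    (hc : c ^ 2 = a ^ 2 + s) :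
    2 • some _ _ (nonsingular_half hs hb hc) = some _ _ (nonsingular_double hs hb hc) := by
  rw [two_nsmul, add_self_of_Y_ne (ne_negY (half_y_ne_zero hs hb hc)), some.injEq,
    slope_half hs hb hc]
  have hX : (quarticTwist (-s ^ 2)).toAffine.addX ((a + b) * (a + c)) ((a + b) * (a + c))
      (a + b + c) = a ^ 2 := by
    simp only [WeierstrassCurve.Affine.addX, quarticTwist]
    linear_combination hb + hc
  refine ⟨hX, ?_⟩
  rw [WeierstrassCurve.Affine.addY, negY_eq, WeierstrassCurve.Affine.negAddY, hX]
  ring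

/- Solve `x = p * q`, `x - s = p * r`, `x + s = q * r`, `y = p * q * r` for `p = a + b`,
`q = a + c`, `r = b + c`. -/
theorem exists_eq_half (hs : s ≠ 0) (h : (quarticTwist (-s ^ 2)).toAffine.Nonsingular x y)
    (hy : y ≠ 0) : ∃ a b c : F, b ^ 2 = a ^ 2 - s ∧ c ^ 2 = a ^ 2 + s ∧
      x = (a + b) * (a + c) ∧ y = (a + b) * (a + c) * (b + c) := by
  rw [nonsingular_neg_sq_iff hs] at h
  obtain ⟨⟨hx, hxs⟩, hxs'⟩ : (x ≠ 0 ∧ x - s ≠ 0) ∧ x + s ≠ 0 := by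
    simpa only [h, mul_ne_zero_iff] using pow_ne_zero 2 hy
  obtain ⟨p, q, r, hpq, hpr, hqr, hpqr⟩ :
      ∃ p q r, x = p * q ∧ x - s = p * r ∧ x + s = q * r ∧ y = p * q * r := by
    refine ⟨y / (x + s), y / (x - s), y / x, ?_, ?_, ?_, ?_⟩ <;> field_simp <;> grind
  refine ⟨(p + q - r) / 2, (p + r - q) / 2, (q + r - p) / 2, ?_, ?_, ?_, ?_⟩ <;> field_simp <;>
    grind

theorem half_parameters_mem {S : Type*} [SetLike S F] [SubfieldClass S F] {K : S}
    (hs : s ≠ 0) (hb : b ^ 2 = a ^ 2 - s) (hc : c ^ 2 = a ^ 2 + s) (hsK : s ∈ K)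
    (hxK : (a + b) * (a + c) ∈ K) (hyK : (a + b) * (a + c) * (b + c) ∈ K) :
    a ∈ K ∧ b ∈ K ∧ c ∈ K := by
  have hy := half_y_ne_zero hs hb hc
  have hbc : b + c ∈ K := by
    rw [← mul_div_cancel_left₀ (b + c) (left_ne_zero_of_mul hy)]
    exact div_mem hyK hxK
  have hac : a + c ∈ K := by
    rw [← mul_div_cancel_right₀ (a + c) (right_ne_zero_of_mul hy), ← half_add hc]
    exact div_mem (add_mem hxK hsK) hbc
  have hab : a + b ∈ K := by
    rw [← mul_div_cancel_right₀ (a + b) (right_ne_zero_of_mul hy), ← half_sub hb]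
    exact div_mem (sub_mem hxK hsK) hbc
  have ha : a ∈ K := by
    have ha_eq : a = ((a + b) + (a + c) - (b + c)) / 2 := by field_simp; ring
    exact ha_eq ▸ div_mem (sub_mem (add_mem hab hac) hbc) (ofNat_mem K 2)
  exact ⟨ha, by simpa using sub_mem hab ha, by simpa using sub_mem hac ha⟩

theorem four_nsmul_eq_zero_iff [DecidableEq F] (hs : s ≠ 0)
    (h : (quarticTwist (-s ^ 2)).toAffine.Nonsingular x y) :
    4 • some x y h = 0 ↔ y = 0 ∨ x ^ 2 = -s ^ 2 ∨ (x - s) ^ 2 = 2 * s ^ 2 ∨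
      (x + s) ^ 2 = 2 * s ^ 2 := by
  rw [show 4 = 2 * 2 from rfl, mul_nsmul]
  rcases eq_or_ne y 0 with hy | hy
  · exact iff_of_true (by rw [(two_nsmul_eq_zero_iff h).2 hy, nsmul_zero]) (.inl hy)
  obtain ⟨a, b, c, hb, hc, rfl, rfl⟩ := exists_eq_half hs h hy
  rw [two_nsmul_half hs hb hc, two_nsmul_eq_zero_iff, mul_eq_zero, mul_eq_zero, or_assoc]
  have h2y := mul_ne_zero (two_ne_zero (α := F)) hy
  have ha : 2 * ((a + b) * (a + c) * (b + c)) * a = ((a + b) * (a + c)) ^ 2 + s ^ 2 := by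
    grind
  have hb : 2 * ((a + b) * (a + c) * (b + c)) * b =
      ((a + b) * (a + c) - s) ^ 2 - 2 * s ^ 2 := by
    grind
  have hc : 2 * ((a + b) * (a + c) * (b + c)) * c =
      ((a + b) * (a + c) + s) ^ 2 - 2 * s ^ 2 := by
    grind
  rw [← mul_eq_zero_iff_left h2y, ha, ← mul_eq_zero_iff_left (b := b) h2y, hb,
    ← mul_eq_zero_iff_left (b := c) h2y, hc, add_eq_zero_iff_eq_neg, sub_eq_zero, sub_eq_zero,
    or_iff_right hy]

end quarticTwist

end Halving

namespace Radicals

variable {Ω S : Type*} [Field Ω] (ρ : Radicals Ω)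

/-- Up to sign, the `x`-coordinates of the affine `4`-torsion points of `y ^ 2 = x ^ 3 - x`. -/
def fourTorsionX : Set Ω := {0, 1, ρ.i, 1 + ρ.w ^ 2, 1 - ρ.w ^ 2}

theorem zero_mem_fourTorsionX : 0 ∈ ρ.fourTorsionX := by simp [fourTorsionX]

theorem i_mem_fourTorsionX : ρ.i ∈ ρ.fourTorsionX := by simp [fourTorsionX]

theorem one_add_w_sq_mem_fourTorsionX : 1 + ρ.w ^ 2 ∈ ρ.fourTorsionX := by simp [fourTorsionX]

theorem hasSqrtIn_of_mem_fourTorsionX [NeZero (2 : Ω)] [SetLike S Ω] [SubfieldClass S Ω] {F : S}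
    (hi : ρ.i ∈ F) (hw : ρ.w ∈ F) (hu : ρ.u ∈ F) {ξ : Ω} (hξ : ξ ∈ ρ.fourTorsionX) :
    HasSqrtIn F ξ ∧ HasSqrtIn F (ξ - 1) ∧ HasSqrtIn F (ξ + 1) := by
  have h1 := hasSqrtIn_one (F := F)
  have hneg := ρ.hasSqrtIn_neg_one hi
  have ht := HasSqrtIn.sq hw
  have hadd := ρ.hasSqrtIn_one_add_w_sq hi hw hu
  have hsub := ρ.hasSqrtIn_one_sub_w_sq hi hw hu
  rcases hξ with rfl | rfl | rfl | rfl | rfl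
  · exact ⟨hasSqrtIn_zero, by rwa [zero_sub], by rwa [zero_add]⟩
  · exact ⟨h1, by simpa using hasSqrtIn_zero, _, pow_mem hw 2, by linear_combination ρ.w_pow_four⟩
  · refine ⟨ρ.zeta_sq ▸ .sq (ρ.zeta_mem hi hw), ?_, ?_⟩
    · simpa using hneg.mul (ρ.hasSqrtIn_one_sub_i hw hu)
    · exact add_comm 1 ρ.i ▸ ρ.u_sq ▸ .sq hu
  · refine ⟨hadd, by rwa [add_sub_cancel_left], ?_⟩
    convert ht.mul hadd using 1
    linear_combination -ρ.w_pow_four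
  · refine ⟨hsub, by simpa using hneg.mul ht, ?_⟩
    convert hneg.mul (ht.mul hsub) using 1
    linear_combination -ρ.w_pow_four

end Radicals

section Torsion

open WeierstrassCurve.Affine WeierstrassCurve.Affine.Point

/-- The coordinates of every affine point of `W` killed by `n` belong to `F`. -/
def HasTorsionIn {Ω S : Type*} [Field Ω] [DecidableEq Ω] [SetLike S Ω] (F : S)
    (W : WeierstrassCurve.Affine Ω) (n : ℕ) : Prop :=
  ∀ x y, ∀ h : W.Nonsingular x y, n • some x y h = 0 → x ∈ F ∧ y ∈ F

open scoped Classical in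
theorem divisionField_le_iff {k : Type*} [Field k] {W : WeierstrassCurve k} {n : ℕ}
    {F : IntermediateField k (AlgebraicClosure k)} :
    divisionField W n ≤ F ↔ HasTorsionIn F (W.baseChange (AlgebraicClosure k)).toAffine n := by
  rw [divisionField, adjoin_le_iff]
  constructor
  · exact fun hF x y h hn => ⟨hF ⟨x, y, h, hn, .inl rfl⟩, hF ⟨x, y, h, hn, .inr rfl⟩⟩
  · rintro hF _ ⟨x, y, h, hn, rfl | rfl⟩
    exacts [(hF _ y h hn).1, (hF x _ h hn).2]

namespace quarticTwist

variable {Ω S : Type*} [Field Ω] [NeZero (2 : Ω)] [DecidableEq Ω] [SetLike S Ω]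
  [SubfieldClass S Ω] {F : S} {s x y : Ω}

theorem mem_of_two_nsmul_some_eq_zero (hs : s ≠ 0) (hsF : s ∈ F)
    (h : (quarticTwist (-s ^ 2)).toAffine.Nonsingular x y) (h2 : 2 • some x y h = 0) :
    x ∈ F ∧ y ∈ F := by
  obtain rfl := (two_nsmul_eq_zero_iff h).1 h2
  rw [nonsingular_neg_sq_iff hs, zero_pow two_ne_zero, eq_comm, mul_eq_zero, mul_eq_zero,
    sub_eq_zero, add_eq_zero_iff_eq_neg] at h
  refine ⟨?_, zero_mem F⟩
  rcases h with (rfl | rfl) | rfl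
  exacts [zero_mem F, hsF, neg_mem hsF]

theorem hasTorsionIn_two_mul_iff [IsAlgClosed Ω] (hs : s ≠ 0) (hsF : s ∈ F) (n : ℕ) :
    HasTorsionIn F (quarticTwist (-s ^ 2)).toAffine (2 * n) ↔
      ∀ x y, ∀ h : (quarticTwist (-s ^ 2)).toAffine.Nonsingular x y, n • some x y h = 0 →
        HasSqrtIn F x ∧ HasSqrtIn F (x - s) ∧ HasSqrtIn F (x + s) := by
  constructor
  · intro hF x y h hn
    obtain ⟨b, hb⟩ := IsAlgClosed.exists_pow_nat_eq (x - s) two_pos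
    obtain ⟨c, hc⟩ := IsAlgClosed.exists_pow_nat_eq (x + s) two_pos
    obtain ⟨a, rfl, rfl⟩ : ∃ a, a ^ 2 = x ∧ a * b * c = y := by
      obtain ⟨a, ha⟩ := IsAlgClosed.exists_pow_nat_eq x two_pos
      have hy : y ^ 2 = (a * b * c) ^ 2 := by
        rw [(nonsingular_neg_sq_iff hs).1 h, mul_pow, mul_pow, ha, hb, hc]
      rcases sq_eq_sq_iff_eq_or_eq_neg.1 hy with rfl | rfl
      exacts [⟨a, ha, rfl⟩, ⟨-a, by rwa [neg_sq], by ring⟩]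
    obtain ⟨hxF, hyF⟩ := hF _ _ (nonsingular_half hs hb hc)
      (by rw [mul_nsmul, two_nsmul_half hs hb hc, hn])
    obtain ⟨ha, hbF, hcF⟩ := half_parameters_mem hs hb hc hsF hxF hyF
    exact ⟨⟨a, ha, rfl⟩, ⟨b, hbF, hb⟩, ⟨c, hcF, hc⟩⟩
  · intro hF x y h hn
    rcases eq_or_ne y 0 with hy | hy
    · exact mem_of_two_nsmul_some_eq_zero hs hsF h ((two_nsmul_eq_zero_iff h).2 hy)
    obtain ⟨a, b, c, hb, hc, rfl, rfl⟩ := exists_eq_half hs h hy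
    rw [mul_nsmul, two_nsmul_half hs hb hc] at hn
    have hF' := hF _ _ _ hn
    rw [← hb, ← hc] at hF'
    simp only [hasSqrtIn_sq_iff] at hF'
    obtain ⟨ha, hb, hc⟩ := hF'
    have hx := mul_mem (add_mem ha hb) (add_mem ha hc)
    exact ⟨hx, mul_mem hx (add_mem hb hc)⟩

theorem four_nsmul_eq_zero_iff_exists (ρ : Radicals Ω) (hs : s ≠ 0)
    (h : (quarticTwist (-s ^ 2)).toAffine.Nonsingular x y) :
    4 • some x y h = 0 ↔ ∃ ξ ∈ ρ.fourTorsionX,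
      x = s * ξ ∨ x = -(s * ξ) := by
  have hy : y = 0 ↔ (x = s * 0 ∨ x = -(s * 0)) ∨ x = s * 1 ∨ x = -(s * 1) := by
    rw [mul_zero, mul_one, _root_.neg_zero, or_self, ← pow_eq_zero_iff two_ne_zero,
      (nonsingular_neg_sq_iff hs).1 h, mul_eq_zero, mul_eq_zero, sub_eq_zero,
      add_eq_zero_iff_eq_neg, or_assoc]
  have hi : x ^ 2 = -s ^ 2 ↔ x = s * ρ.i ∨ x = -(s * ρ.i) := by
    rw [← sq_eq_sq_iff_eq_or_eq_neg, mul_pow, ρ.i_sq, mul_neg_one]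
  have hw (z : Ω) : z ^ 2 = 2 * s ^ 2 ↔ z = s * ρ.w ^ 2 ∨ z = -(s * ρ.w ^ 2) := by
    rw [← sq_eq_sq_iff_eq_or_eq_neg, mul_pow, ← pow_mul, ρ.w_pow_four, mul_comm]
  have hsub : (x - s) ^ 2 = 2 * s ^ 2 ↔ x = s * (1 + ρ.w ^ 2) ∨ x = s * (1 - ρ.w ^ 2) := by
    rw [hw, sub_eq_iff_eq_add', sub_eq_iff_eq_add', ← sub_eq_add_neg, mul_one_add, mul_one_sub]
  have hadd : (x + s) ^ 2 = 2 * s ^ 2 ↔ x = -(s * (1 + ρ.w ^ 2)) ∨ x = -(s * (1 - ρ.w ^ 2)) := by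
    rw [hw, ← eq_sub_iff_add_eq, ← eq_sub_iff_add_eq, mul_one_add, mul_one_sub, neg_sub,
      neg_add_rev, or_comm, sub_eq_add_neg (-_)]
  have hw_coords := or_congr hsub hadd
  rw [or_or_or_comm] at hw_coords
  rw [four_nsmul_eq_zero_iff hs, hy, hi, hw_coords]
  simp only [Radicals.fourTorsionX, Set.mem_insert_iff, Set.mem_singleton_iff, exists_eq_or_imp,
    exists_eq_left, or_assoc]

theorem hasSqrtIn_of_four_nsmul_eq_zero (ρ : Radicals Ω) (hs : HasSqrtIn F s) (hs0 : s ≠ 0)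
    (hi : ρ.i ∈ F) (hw : ρ.w ∈ F) (hu : ρ.u ∈ F)
    (h : (quarticTwist (-s ^ 2)).toAffine.Nonsingular x y) (h4 : 4 • some x y h = 0) :
    HasSqrtIn F x ∧ HasSqrtIn F (x - s) ∧ HasSqrtIn F (x + s) := by
  obtain ⟨ξ, hξ, hx⟩ := (four_nsmul_eq_zero_iff_exists ρ hs0 h).1 h4
  obtain ⟨h0, hsub, hadd⟩ := ρ.hasSqrtIn_of_mem_fourTorsionX hi hw hu hξ
  have hneg := ρ.hasSqrtIn_neg_one hi
  rcases hx with rfl | rfl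
  · refine ⟨hs.mul h0, ?_, ?_⟩
    · simpa only [mul_sub_one] using hs.mul hsub
    · simpa only [mul_add_one] using hs.mul hadd
  · refine ⟨?_, ?_, ?_⟩
    · simpa only [neg_one_mul] using hneg.mul (hs.mul h0)
    · simpa only [mul_add_one, neg_one_mul, neg_add'] using hneg.mul (hs.mul hadd)
    · simpa only [mul_sub_one, neg_one_mul, neg_sub', sub_neg_eq_add] using hneg.mul (hs.mul hsub)

omit [SubfieldClass S Ω] in
theorem mem_of_hasTorsionIn_eight (hs : s ≠ 0)
    (h8 : HasTorsionIn F (quarticTwist (-s ^ 2)).toAffine 8) : s ∈ F := by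
  have h : (quarticTwist (-s ^ 2)).toAffine.Nonsingular s 0 := by
    rw [nonsingular_neg_sq_iff hs]
    ring
  refine (h8 _ _ h ?_).1
  rw [show 8 = 2 * 4 from rfl, mul_nsmul, (two_nsmul_eq_zero_iff h).2 rfl, nsmul_zero]

theorem hasSqrtIn_mul_of_hasTorsionIn_eight [IsAlgClosed Ω] (ρ : Radicals Ω) (hs : s ≠ 0)
    (h8 : HasTorsionIn F (quarticTwist (-s ^ 2)).toAffine 8) {ξ : Ω} (hξ : ξ ∈ ρ.fourTorsionX) :
    HasSqrtIn F (s * ξ) ∧ HasSqrtIn F (s * ξ - s) ∧ HasSqrtIn F (s * ξ + s) := by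
  obtain ⟨y, hy⟩ := IsAlgClosed.exists_pow_nat_eq (s * ξ * (s * ξ - s) * (s * ξ + s)) two_pos
  have h := (nonsingular_neg_sq_iff hs).2 hy
  have h4 : 4 • some _ y h = 0 := (four_nsmul_eq_zero_iff_exists ρ hs h).2 ⟨ξ, hξ, .inl rfl⟩
  exact (hasTorsionIn_two_mul_iff hs (mem_of_hasTorsionIn_eight hs h8) 4).1 h8 _ _ h h4

theorem hasTorsionIn_eight_neg_pow_four_iff [IsAlgClosed Ω] (ρ : Radicals Ω) {g : Ω} (hg : g ≠ 0) :
    HasTorsionIn F (quarticTwist (-(g ^ 2) ^ 2)).toAffine 8 ↔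
      (ρ.i ∈ F ∧ ρ.w ∈ F ∧ ρ.u ∈ F) ∧ g ∈ F := by
  have hs : g ^ 2 ≠ 0 := pow_ne_zero 2 hg
  constructor
  · intro h8
    have h_zero := hasSqrtIn_mul_of_hasTorsionIn_eight ρ hs h8 ρ.zero_mem_fourTorsionX
    have h_i := hasSqrtIn_mul_of_hasTorsionIn_eight ρ hs h8 ρ.i_mem_fourTorsionX
    have h_w := hasSqrtIn_mul_of_hasTorsionIn_eight ρ hs h8 ρ.one_add_w_sq_mem_fourTorsionX
    have hgF : g ∈ F := by
      have h := h_zero.2.2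
      rwa [mul_zero, zero_add, hasSqrtIn_sq_iff] at h
    have mem_of_hasSqrtIn {r z : Ω} (h : HasSqrtIn F z) (hz : z = (g * r) ^ 2) : r ∈ F := by
      rw [hz, hasSqrtIn_sq_iff] at h
      simpa [hg] using div_mem h hgF
    have hi : ρ.i ∈ F := mem_of_hasSqrtIn h_zero.2.1 (by linear_combination -g ^ 2 * ρ.i_sq)
    have hw : ρ.w ∈ F := mem_of_hasSqrtIn h_w.2.1 (by ring)
    have hu : ρ.u ∈ F := mem_of_hasSqrtIn h_i.2.2 (by linear_combination -g ^ 2 * ρ.u_sq)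
    exact ⟨⟨hi, hw, hu⟩, hgF⟩
  · rintro ⟨⟨hi, hw, hu⟩, hgF⟩
    exact (hasTorsionIn_two_mul_iff hs (pow_mem hgF 2) 4).2 fun x y h h4 =>
      hasSqrtIn_of_four_nsmul_eq_zero ρ (.sq hgF) hs hi hw hu h h4

theorem hasTorsionIn_eight_pow_four_iff [IsAlgClosed Ω] (ρ : Radicals Ω) {δ : Ω} (hδ : δ ≠ 0) :
    HasTorsionIn F (quarticTwist (δ ^ 4)).toAffine 8 ↔
      (ρ.i ∈ F ∧ ρ.w ∈ F ∧ ρ.u ∈ F) ∧ δ ∈ F := by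
  have hζ0 : ρ.zeta ≠ 0 := by
    intro h
    simpa [h] using ρ.zeta_pow_four
  have hδ_eq : δ ^ 4 = -((ρ.zeta * δ) ^ 2) ^ 2 := by
    linear_combination δ ^ 4 * ρ.zeta_pow_four
  rw [hδ_eq, hasTorsionIn_eight_neg_pow_four_iff ρ (mul_ne_zero hζ0 hδ)]
  refine and_congr_right fun ⟨hi, hw, _⟩ => ?_
  have hζ := ρ.zeta_mem hi hw
  exact ⟨fun h => by simpa [hζ0] using div_mem h hζ, fun h => mul_mem hζ h⟩

theorem divisionField_eight_eq {k : Type*} [Field k] [NeZero (2 : AlgebraicClosure k)]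
    (ρ : Radicals (AlgebraicClosure k)) {a : k} (ha : a ≠ 0) {δ : AlgebraicClosure k}
    (hδ : δ ^ 4 = algebraMap k _ a) :
    divisionField (quarticTwist a) 8 = ρ.field k ⊔ k⟮δ⟯ := by
  classical
  have hδ0 : δ ≠ 0 := by
    rintro rfl
    exact ha (by simpa using hδ.symm)
  refine eq_of_forall_ge_iff fun F => ?_
  rw [divisionField_le_iff, baseChange_eq, ← hδ, hasTorsionIn_eight_pow_four_iff ρ hδ0, sup_le_iff,
    ρ.field_le_iff, adjoin_simple_le_iff]

end quarticTwist

end Torsion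

section Arithmetic

variable {d t : ℤ}

theorem isUnit_of_forall_prime_not_dvd (h : ∀ p : ℕ, p.Prime → ¬ (p : ℤ) ∣ t) : IsUnit t := by
  rw [Int.isUnit_iff_natAbs_eq]
  by_contra hne
  obtain ⟨p, hp, hpt⟩ := Nat.exists_prime_and_dvd hne
  exact h p hp (Int.natCast_dvd.2 hpt)

theorem FourthPowerFree.isUnit_of_pow_four_dvd (hd : FourthPowerFree d) (h : t ^ 4 ∣ d) :
    IsUnit t :=
  isUnit_of_forall_prime_not_dvd fun p hp hpt => hd p hp ((pow_dvd_pow_of_dvd hpt 4).trans h)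

theorem FourthPowerFree.squarefree_of_sq_dvd (hd : FourthPowerFree d) (h : t ^ 2 ∣ d) :
    Squarefree t := fun q hq =>
  hd.isUnit_of_pow_four_dvd <| calc
    q ^ 4 = (q * q) ^ 2 := by ring
    _ ∣ t ^ 2 := pow_dvd_pow_of_dvd hq 2
    _ ∣ d := h

theorem exists_eq_mul_pow_of_intCast_eq_mul_pow {c : ℤ} {n : ℕ} (hc0 : c ≠ 0) (hc : |c| < 2 ^ n)
    {r : ℚ} (h : (d : ℚ) = c * r ^ n) : ∃ m : ℤ, d = c * m ^ n := by
  have hnum : d * (r.den : ℤ) ^ n = c * r.num ^ n := by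
    rw [← r.num_div_den, div_pow, ← mul_div_assoc, eq_div_iff (by positivity)] at h
    exact_mod_cast h
  have hdvd : (r.den : ℤ) ^ n ∣ c :=
    (r.isCoprime_num_den.symm.pow (m := n) (n := n)).dvd_of_dvd_mul_right
      (hnum ▸ dvd_mul_left _ d)
  have hden : r.den = 1 := by
    have hlt : r.den ^ n < 2 ^ n := by
      have hle := Int.le_of_dvd (abs_pos.2 hc0) ((dvd_abs _ _).2 hdvd)
      exact_mod_cast hle.trans_lt hc
    have := lt_of_pow_lt_pow_left₀ n two_pos.le hlt
    have := r.den_pos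
    omega
  exact ⟨r.num, by simpa [hden] using hnum⟩

theorem exists_intCast_eq_mul_pow_iff {C : Set ℤ} {n : ℕ} (hC : ∀ c ∈ C, c ≠ 0 ∧ |c| < 2 ^ n) :
    (∃ c ∈ ((↑) '' C : Set ℚ), ∃ r : ℚ, (d : ℚ) = c * r ^ n) ↔
      ∃ c ∈ C, ∃ m : ℤ, d = c * m ^ n := by
  rw [Set.exists_mem_image]
  refine exists_congr fun c => and_congr_right fun hc => ⟨fun ⟨r, hr⟩ => ?_, fun ⟨m, hm⟩ => ?_⟩
  · exact exists_eq_mul_pow_of_intCast_eq_mul_pow (hC c hc).1 (hC c hc).2 hr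
  · exact ⟨m, by exact_mod_cast hm⟩

theorem FourthPowerFree.exists_eq_mul_pow_four_iff (hd : FourthPowerFree d) :
    (∃ c ∈ ({1, -1, 2, -2, 4, -4, 8, -8} : Set ℚ), ∃ r, (d : ℚ) = c * r ^ 4) ↔
      d ∈ ({1, -1, 2, -2, 4, -4, 8, -8} : Set ℤ) := by
  have h := exists_intCast_eq_mul_pow_iff (d := d) (n := 4)
    (C := {1, -1, 2, -2, 4, -4, 8, -8}) (by simp)
  simp only [Set.image_insert_eq, Set.image_singleton, Int.cast_neg, Int.cast_one,
    Int.cast_ofNat] at h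
  rw [h]
  constructor
  · rintro ⟨c, hc, m, rfl⟩
    have hm := hd.isUnit_of_pow_four_dvd (dvd_mul_left (m ^ 4) c)
    rwa [← (by decide : Even 4).pow_abs m, Int.isUnit_iff_abs_eq.1 hm, one_pow, mul_one]
  · exact fun hmem => ⟨d, hmem, 1, by ring⟩

theorem exists_eq_mul_sq_iff :
    (∃ e ∈ ({1, -1, 2, -2} : Set ℚ), ∃ r, (d : ℚ) = e * r ^ 2) ↔
      ∃ t : ℤ, d = t ^ 2 ∨ d = -t ^ 2 ∨ d = 2 * t ^ 2 ∨ d = -(2 * t ^ 2) := by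
  have h := exists_intCast_eq_mul_pow_iff (d := d) (n := 2) (C := {1, -1, 2, -2}) (by simp)
  simp only [Set.image_insert_eq, Set.image_singleton, Int.cast_neg, Int.cast_one,
    Int.cast_ofNat] at h
  rw [h]
  simp only [Set.mem_insert_iff, Set.mem_singleton_iff, exists_eq_or_imp, exists_eq_left,
    ← exists_or, one_mul, neg_mul]

theorem FourthPowerFree.exists_squarefree_iff (hd : FourthPowerFree d) :
    (∃ t : ℤ, Squarefree t ∧ t ∉ ({1, -1, 2, -2} : Set ℤ) ∧
        (d = t ^ 2 ∨ d = -t ^ 2 ∨ d = 2 * t ^ 2 ∨ d = -(2 * t ^ 2))) ↔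
      d ∉ ({1, -1, 2, -2, 4, -4, 8, -8} : Set ℤ) ∧
        ∃ t : ℤ, d = t ^ 2 ∨ d = -t ^ 2 ∨ d = 2 * t ^ 2 ∨ d = -(2 * t ^ 2) := by
  constructor
  · rintro ⟨t, hsq, ht, h⟩
    refine ⟨fun hmem => ?_, t, h⟩
    have ht0 := hsq.ne_zero
    simp only [Set.mem_insert_iff, Set.mem_singleton_iff] at ht hmem
    have ht9 : 9 ≤ t ^ 2 := by
      rcases (by omega : t ≤ -3 ∨ 3 ≤ t) with h | h <;> nlinarith
    omega
  · rintro ⟨hmem, t, h⟩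
    refine ⟨t, hd.squarefree_of_sq_dvd ?_, fun ht => hmem ?_, h⟩
    · rcases h with rfl | rfl | rfl | rfl <;> simp
    · simp only [Set.mem_insert_iff, Set.mem_singleton_iff] at ht ⊢
      rcases ht with rfl | rfl | rfl | rfl <;> norm_num at h <;> omega

theorem independentNegOneTwo_rat : IndependentNegOneTwo ℚ where
  not_isSquare_neg_one h := by linarith [h.nonneg]
  not_isSquare_two := by
    rw [← Nat.cast_ofNat, Rat.isSquare_natCast_iff]
    exact Nat.prime_two.not_isSquare
  not_isSquare_neg_two h := by linarith [h.nonneg]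

end Arithmetic

theorem mainTheorem12_general {k : Type*} [Field k] (hk : IndependentNegOneTwo k) (a : k)
    (ha : a ≠ 0) :
    (Module.finrank k (divisionField (quarticTwist a) 8) = 16 ↔
      ∃ c ∈ ({1, -1, 2, -2, 4, -4, 8, -8} : Set k), ∃ r, a = c * r ^ 4) ∧
    (Module.finrank k (divisionField (quarticTwist a) 8) = 32 ↔
      (¬ ∃ c ∈ ({1, -1, 2, -2, 4, -4, 8, -8} : Set k), ∃ r, a = c * r ^ 4) ∧
        ∃ e ∈ ({1, -1, 2, -2} : Set k), ∃ r, a = e * r ^ 2) ∧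
    ((¬ ∃ c ∈ ({1, -1, 2, -2, 4, -4, 8, -8} : Set k), ∃ r, a = c * r ^ 4) →
      (¬ ∃ e ∈ ({1, -1, 2, -2} : Set k), ∃ r, a = e * r ^ 2) →
      Module.finrank k (divisionField (quarticTwist a) 8) = 64) := by
  have := hk.neZero_two (AlgebraicClosure k)
  obtain ⟨ρ⟩ := Radicals.nonempty_of_isAlgClosed (AlgebraicClosure k)
  obtain ⟨δ, hδ⟩ := IsAlgClosed.exists_pow_nat_eq (algebraMap k (AlgebraicClosure k) a) four_pos
  have hsq : δ ^ 2 ∈ ρ.field k ↔ ∃ e ∈ ({1, -1, 2, -2} : Set k), ∃ r, a = e * r ^ 2 := by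
    rw [← ρ.hasSqrtIn_field_iff hk, ← hδ, show δ ^ 4 = (δ ^ 2) ^ 2 by ring, hasSqrtIn_sq_iff]
  rw [quarticTwist.divisionField_eight_eq ρ ha hδ, ← ρ.mem_field_iff_of_pow_four_eq hk hδ, ← hsq]
  by_cases hmem : δ ∈ ρ.field k
  · rw [sup_eq_left.2 (adjoin_simple_le_iff.2 hmem)]
    simp [ρ.finrank_field hk, hmem]
  by_cases hmem_sq : δ ^ 2 ∈ ρ.field k
  · simp [ρ.finrank_field_sup_adjoin_of_sq_mem hk hmem_sq hmem, hmem, hmem_sq]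
  · have hδ4 : δ ^ 4 ∈ ρ.field k := hδ ▸ IntermediateField.algebraMap_mem _ a
    simp [ρ.finrank_field_sup_adjoin_of_pow_four_mem hk hδ4 hmem_sq, hmem, hmem_sq]

theorem mainTheorem12 (d : ℤ) (hd0 : d ≠ 0) (hd : FourthPowerFree d) :
    (Module.finrank ℚ (divisionField (curveE d) 8) = 16 ↔
      d ∈ ({1, -1, 2, -2, 4, -4, 8, -8} : Set ℤ)) ∧
    (Module.finrank ℚ (divisionField (curveE d) 8) = 32 ↔
      ∃ t : ℤ, Squarefree t ∧ t ∉ ({1, -1, 2, -2} : Set ℤ) ∧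
        (d = t ^ 2 ∨ d = -t ^ 2 ∨ d = 2 * t ^ 2 ∨ d = -(2 * t ^ 2))) ∧
    (d ∉ ({1, -1, 2, -2, 4, -4, 8, -8} : Set ℤ) →
      (¬ ∃ t : ℤ, Squarefree t ∧ t ∉ ({1, -1, 2, -2} : Set ℤ) ∧
        (d = t ^ 2 ∨ d = -t ^ 2 ∨ d = 2 * t ^ 2 ∨ d = -(2 * t ^ 2))) →
      Module.finrank ℚ (divisionField (curveE d) 8) = 64) := by
  have h := mainTheorem12_general independentNegOneTwo_rat d (Int.cast_ne_zero.2 hd0)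
  rw [hd.exists_eq_mul_pow_four_iff, exists_eq_mul_sq_iff] at h
  rw [hd.exists_squarefree_iff]
  exact ⟨h.1, h.2.1, fun hA hB => h.2.2 hA fun hsq => hB ⟨hA, hsq⟩⟩
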